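/- Let $\mathbb{R}^2$ carry the Euclidean norm. A full-rank lattice $\Lambda\subset\mathbb{R}^2$ is called \emph{well-rounded} if its minimal vectors, i.e. the vectors $x\in\Lambda$ with $\|x\| = |\Lambda| := \min\{\|y\| : y\in\Lambda\setminus\{0\}\}$, span $\mathbb{R}^2$ over $\mathbb{R}$. For a positive integer $u$ let $\mathcal{N}(u)$ be the number of full-rank well-rounded sublattices $\Lambda\subseteq\mathbb{Z}^2$ with determinant (covolume) equal to $u$. Let $p$ be a prime, let $k\ge 1$ be an integer, and let $u=p^k$ or $u=2p^k$. Then \[ \mathcal{N}(u)=\begin{cases} 0 & \text{if } p\equiv 3 \pmod 4 \text{ and } k \text{ is odd},\\ 1 & \text{if } p\equiv 3 \pmod 4 \text{ and } k \text{ is even},\\ 1 & \text{if } p=2,\\ k+1 & \text{if } p\equiv 1 \pmod 4. \end{cases} \] -/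

import Mathlib

/-- The integer lattice `ℤⁿ` in the Euclidean space `ℝⁿ`. -/
noncomputable def integerLattice (n : ℕ) : Submodule ℤ (EuclideanSpace ℝ (Fin n)) :=
  Submodule.span ℤ (Set.range (EuclideanSpace.basisFun (Fin n) ℝ))

/-- The set `S(Λ)` of minimal vectors of `Λ`: the vectors `x ∈ Λ` whose Euclidean norm equals
the minimum `|Λ| = min {‖y‖ : y ∈ Λ, y ≠ 0}`. -/
def minimalVectors {n : ℕ} (L : Submodule ℤ (EuclideanSpace ℝ (Fin n))) :
    Set (EuclideanSpace ℝ (Fin n)) :=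
  {x | x ∈ L ∧ IsLeast {r : ℝ | ∃ y ∈ L, y ≠ 0 ∧ r = ‖y‖} ‖x‖}

/-- `Λ` is well-rounded if its minimal vectors span `ℝⁿ`. -/
def IsWellRounded {n : ℕ} (L : Submodule ℤ (EuclideanSpace ℝ (Fin n))) : Prop :=
  Submodule.span ℝ (minimalVectors L) = ⊤

/-- `WR(Ω)`: the set of full-rank well-rounded sublattices of the lattice `Ω`. -/
def WR {n : ℕ} (Ω : Submodule ℤ (EuclideanSpace ℝ (Fin n))) :
    Set (Submodule ℤ (EuclideanSpace ℝ (Fin n))) :=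
  {L | L ≤ Ω ∧ Submodule.span ℝ (L : Set (EuclideanSpace ℝ (Fin n))) = ⊤ ∧ IsWellRounded L}

/-- `𝒩(u)`: the number of lattices in `WR(ℤ²)` of determinant `u` (the determinant of a full-rank
lattice being its covolume for Lebesgue measure). The value in `ℕ∞` records finiteness as well. -/
noncomputable def numWR (u : ℕ) : ℕ∞ :=
  Set.encard {L | L ∈ WR (integerLattice 2) ∧ ZLattice.covolume L = (u : ℝ)}

/-! Identify `ℤ²` with `ℤ[i]`. Independent minimal vectors `a`, `b` of a well-rounded sublattice
generate it (`IsMinimalIn.eq_span_pair`). Let `N` be their common norm and `c` their inner product.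
Then `2|c| ≤ N` and `c² + u² = N²`, so `(N + c)(N - c) = u²` with factors within a ratio 3 of each
other. For `u = p^k` or `2p^k` this forces `c = 0` (`eq_zero_of_sq_add_sq_eq_sq`). Hence `b = ±i a`,
and the lattice is the ideal `(a)` with `N = u`. Conversely, every nonzero ideal `(a)` is
well-rounded, with minimal vectors `a` and `i a`. What remains is to count ideals of norm `u`: a
factor 2 is absorbed by the ramified prime `1 + i`, and the rest depends on whether `p` is ramified,
inert or split. -/

/-- The ideals of `ℤ[i]` generated by an element of norm `n`. -/
def idealsOfNorm (n : ℤ) : Set (Ideal GaussianInt) :=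
  {I | ∃ a : GaussianInt, a.norm = n ∧ I = Ideal.span {a}}

/-! ### Counting ideals of given norm in `ℤ[i]` -/

theorem GaussianInt.norm_eq_sq_add_sq (a : GaussianInt) : a.norm = a.re ^ 2 + a.im ^ 2 := by
  rw [Zsqrtd.norm_def]; ring

theorem GaussianInt.norm_eq_of_associated {a b : GaussianInt} (h : Associated a b) :
    a.norm = b.norm := by
  obtain ⟨v, rfl⟩ := h
  have h1 : ((v : GaussianInt).norm.natAbs : ℤ) = v.1.norm := GaussianInt.abs_natCast_norm _
  rw [Zsqrtd.norm_eq_one_iff.2 v.isUnit] at h1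
  rw [Zsqrtd.norm_mul, ← h1]; simp

theorem GaussianInt.norm_pow (a : GaussianInt) (n : ℕ) : (a ^ n).norm = a.norm ^ n :=
  map_pow Zsqrtd.normMonoidHom a n

theorem GaussianInt.norm_star (a : GaussianInt) : (star a).norm = a.norm := by
  simp [GaussianInt.norm_eq_sq_add_sq]

theorem GaussianInt.dvd_norm (a : GaussianInt) : a ∣ (a.norm : GaussianInt) :=
  ⟨star a, Zsqrtd.norm_eq_mul_conj a⟩

/-- An element of even norm is divisible by `1 + i`, so multiplication by `(1 + i)` is a bijection
between the two sets. -/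
theorem encard_idealsOfNorm_two_mul (n : ℤ) :
    (idealsOfNorm (2 * n)).encard = (idealsOfNorm n).encard := by
  set q : GaussianInt := ⟨1, 1⟩ with hq
  have hqn : q.norm = 2 := by simp [GaussianInt.norm_eq_sq_add_sq, hq]
  have hq0 : q ≠ 0 := by rintro h; simp [h] at hqn
  have hinj : Function.Injective (fun I : Ideal GaussianInt => Ideal.span {q} * I) :=
    fun I J h => (Ideal.span_singleton_mul_right_inj hq0).1 h
  rw [← hinj.encard_image (idealsOfNorm n)]
  congr 1
  ext I
  constructor
  · rintro ⟨a, ha, rfl⟩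
    rw [GaussianInt.norm_eq_sq_add_sq] at ha
    have h2 : (2 : ℤ) ∣ a.re + a.im := by
      have h : Even (a.re ^ 2 + a.im ^ 2) := ⟨n, by rw [ha]; ring⟩
      have h' : Even (a.re + a.im) := by simpa [parity_simps] using h
      exact h'.two_dvd
    obtain ⟨m, hm⟩ := h2
    have hab : a = q * ⟨m, m - a.re⟩ := by
      ext <;> (simp [hq]; try linarith)
    refine ⟨Ideal.span {⟨m, m - a.re⟩}, ⟨_, ?_, rfl⟩, ?_⟩
    · have := congrArg Zsqrtd.norm hab
      rw [Zsqrtd.norm_mul, hqn, GaussianInt.norm_eq_sq_add_sq, ha] at this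
      linarith
    · simp only [Ideal.span_singleton_mul_span_singleton]
      rw [← hab]
  · rintro ⟨_, ⟨a, ha, rfl⟩, rfl⟩
    refine ⟨q * a, ?_, ?_⟩
    · rw [Zsqrtd.norm_mul, hqn, ha]
    · simp only [Ideal.span_singleton_mul_span_singleton]

theorem idealsOfNorm_one : idealsOfNorm 1 = {⊤} := by
  ext I
  simp only [Set.mem_singleton_iff]
  constructor
  · rintro ⟨a, ha, rfl⟩
    rw [Ideal.span_singleton_eq_top, ← Zsqrtd.norm_eq_one_iff, ha]; rfl
  · rintro rfl
    exact ⟨1, by simp, by simp⟩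

theorem encard_idealsOfNorm_two_pow (k : ℕ) : (idealsOfNorm (2 ^ k)).encard = 1 := by
  induction k with
  | zero => simp [idealsOfNorm_one]
  | succ k ih => rw [pow_succ', encard_idealsOfNorm_two_mul, ih]

/-- Here `p` is inert, and `a` divides its own norm `p ^ k`. -/
theorem associated_pow_of_norm_eq_prime_pow {p k : ℕ} (hp : p.Prime) (hp3 : p % 4 = 3)
    {a : GaussianInt} (ha : a.norm = (p : ℤ) ^ k) :
    ∃ j, k = 2 * j ∧ Associated a ((p : GaussianInt) ^ j) := by
  have := Fact.mk hp
  have hP := GaussianInt.prime_of_nat_prime_of_mod_four_eq_three p hp3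
  have hd := a.dvd_norm
  rw [ha] at hd
  push_cast at hd
  obtain ⟨j, -, hj⟩ := (dvd_prime_pow hP k).1 hd
  refine ⟨j, ?_, hj⟩
  have h := GaussianInt.norm_eq_of_associated hj
  rw [ha, GaussianInt.norm_pow, Zsqrtd.norm_natCast, ← pow_two, ← pow_mul] at h
  exact Nat.pow_right_injective hp.two_le (by exact_mod_cast h)

theorem idealsOfNorm_odd_pow {p k : ℕ} (hp : p.Prime) (hp3 : p % 4 = 3) (hk : Odd k) :
    idealsOfNorm ((p : ℤ) ^ k) = ∅ := by
  refine Set.eq_empty_of_forall_notMem ?_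
  rintro _ ⟨a, ha, rfl⟩
  obtain ⟨j, hj, -⟩ := associated_pow_of_norm_eq_prime_pow hp hp3 ha
  exact (Nat.not_even_iff_odd.2 hk) (hj ▸ even_two_mul j)

theorem encard_idealsOfNorm_even_pow {p k : ℕ} (hp : p.Prime) (hp3 : p % 4 = 3) (hk : Even k) :
    (idealsOfNorm ((p : ℤ) ^ k)).encard = 1 := by
  obtain ⟨m, hm⟩ := hk
  rw [Set.encard_eq_one]
  refine ⟨Ideal.span {(p : GaussianInt) ^ m}, ?_⟩
  ext I
  simp only [Set.mem_singleton_iff]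
  constructor
  · rintro ⟨a, ha, rfl⟩
    obtain ⟨j, hj, h⟩ := associated_pow_of_norm_eq_prime_pow hp hp3 ha
    obtain rfl : j = m := by omega
    exact Ideal.span_singleton_eq_span_singleton.2 h
  · rintro rfl
    refine ⟨_, ?_, rfl⟩
    rw [GaussianInt.norm_pow, Zsqrtd.norm_natCast, ← pow_two, ← pow_mul, hm, two_mul]

theorem GaussianInt.prime_of_norm_eq_prime {p : ℕ} (hp : p.Prime) {a : GaussianInt}
    (ha : a.norm = p) : Prime a := by
  rw [← irreducible_iff_prime]
  have hna : a.norm.natAbs = p := by rw [ha]; rfl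
  refine ⟨fun h => ?_, fun b c hbc => ?_⟩
  · rw [Zsqrtd.norm_eq_one_iff.2 h] at hna
    exact hp.one_lt.ne hna
  · have h := congrArg (fun z : GaussianInt => z.norm.natAbs) hbc
    simp only [hna, Zsqrtd.norm_mul, Int.natAbs_mul] at h
    rw [← Zsqrtd.norm_eq_one_iff, ← Zsqrtd.norm_eq_one_iff]
    rw [h] at hp
    rcases Nat.prime_mul_iff.1 hp with h | h
    · exact Or.inr h.2
    · exact Or.inl h.2

theorem GaussianInt.exists_split_prime {p : ℕ} (hp : p.Prime) (hp1 : p % 4 = 1) :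
    ∃ q : GaussianInt, q.norm = p ∧ ¬ q ∣ star q := by
  have := Fact.mk hp
  obtain ⟨x, y, hxy⟩ := Nat.Prime.sq_add_sq (p := p) (by omega)
  refine ⟨⟨x, y⟩, by rw [GaussianInt.norm_eq_sq_add_sq]; simpa using congrArg (Nat.cast (R := ℤ)) hxy, fun h => ?_⟩
  -- If `q` divides its conjugate, it divides the trace `2x`; taking norms gives `p ∣ (2x)²`.
  have hsum : (⟨x, y⟩ : GaussianInt) ∣ ((2 * x : ℤ) : GaussianInt) := by
    have h' := dvd_add (dvd_refl (⟨x, y⟩ : GaussianInt)) h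
    convert h' using 1
    ext <;> simp
    ring
  have hn := map_dvd (Zsqrtd.normMonoidHom (d := -1)) hsum
  have h1 : Zsqrtd.normMonoidHom (⟨x, y⟩ : GaussianInt) = (p : ℤ) := by
    change Zsqrtd.norm _ = _
    rw [GaussianInt.norm_eq_sq_add_sq]; simpa using congrArg (Nat.cast (R := ℤ)) hxy
  have h2 : Zsqrtd.normMonoidHom ((2 * x : ℤ) : GaussianInt) = ((2 * x * (2 * x) : ℕ) : ℤ) := by
    change Zsqrtd.norm _ = _
    rw [Zsqrtd.norm_intCast]; push_cast; ring
  rw [h1, h2, Int.natCast_dvd_natCast, hp.dvd_mul, or_self, hp.dvd_mul] at hn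
  have hp2 : ¬ p ∣ 2 := fun h => by
    have := Nat.le_of_dvd two_pos h
    have : p = 2 := le_antisymm this hp.two_le
    omega
  have hpx : p ∣ x := hn.resolve_left hp2
  have hx0 : x = 0 := by
    by_contra hx
    have := Nat.le_of_dvd (Nat.pos_of_ne_zero hx) hpx
    nlinarith [hp.two_le]
  subst hx0
  have hy : p = y ^ 2 := by simpa using hxy.symm
  exact (Nat.Prime.prime hp).not_isSquare ⟨y, by rw [← pow_two]; exact hy⟩

theorem associated_pow_mul_pow_inj {q r : GaussianInt} (hq : Prime q)
    (hqr : ¬ q ∣ r) {k i j : ℕ} (hij : i < j)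
    (h : Associated (q ^ i * r ^ (k - i)) (q ^ j * r ^ (k - j))) : False := by
  have hd : q ^ i * q ∣ q ^ i * r ^ (k - i) := by
    refine Dvd.dvd.trans ?_ h.symm.dvd
    rw [← pow_succ]
    exact Dvd.dvd.mul_right (pow_dvd_pow q hij) _
  have := (mul_dvd_mul_iff_left (pow_ne_zero i hq.ne_zero)).1 hd
  exact hqr (hq.dvd_of_dvd_pow this)

/-- As `p = q * star q` with non-associated primes, unique factorization leaves only the exponent of
`q`, from 0 to `k`, to choose. -/
theorem encard_idealsOfNorm_split_pow {p : ℕ} (k : ℕ) (hp : p.Prime) (hp1 : p % 4 = 1) :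
    (idealsOfNorm ((p : ℤ) ^ k)).encard = (k : ℕ∞) + 1 := by
  obtain ⟨q, hqn, hq⟩ := GaussianInt.exists_split_prime hp hp1
  have hsn : (star q).norm = p := by rw [GaussianInt.norm_star, hqn]
  have hqP := GaussianInt.prime_of_norm_eq_prime hp hqn
  have hsP := GaussianInt.prime_of_norm_eq_prime hp hsn
  have himg : idealsOfNorm ((p : ℤ) ^ k) =
      (fun i => Ideal.span {q ^ i * star q ^ (k - i)}) '' (Finset.range (k + 1) : Set ℕ) := by
    ext I
    constructor
    · rintro ⟨a, ha, rfl⟩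
      have hd := a.dvd_norm
      rw [ha, ← hqn] at hd
      push_cast at hd
      rw [Zsqrtd.norm_eq_mul_conj, mul_pow] at hd
      obtain ⟨b, c, hb, hc, rfl⟩ := exists_dvd_and_dvd_of_dvd_mul hd
      obtain ⟨i, hi, hbi⟩ := (dvd_prime_pow hqP k).1 hb
      obtain ⟨j, hj, hcj⟩ := (dvd_prime_pow hsP k).1 hc
      have hA := hbi.mul_mul hcj
      have hN := GaussianInt.norm_eq_of_associated hA
      rw [ha, Zsqrtd.norm_mul, GaussianInt.norm_pow, GaussianInt.norm_pow, hqn, hsn,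
        ← pow_add] at hN
      have hk : k = i + j := Nat.pow_right_injective hp.two_le (by exact_mod_cast hN)
      refine ⟨i, by simp; omega, ?_⟩
      have : k - i = j := by omega
      simp only [this]
      exact Ideal.span_singleton_eq_span_singleton.2 hA.symm
    · rintro ⟨i, hi, rfl⟩
      have hi' : i ≤ k := by simpa [Nat.lt_succ_iff] using hi
      refine ⟨_, ?_, rfl⟩
      rw [Zsqrtd.norm_mul, GaussianInt.norm_pow, GaussianInt.norm_pow, hqn, hsn, ← pow_add]
      congr 1; omega
  rw [himg, Set.InjOn.encard_image, Set.encard_coe_eq_coe_finsetCard]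
  · simp
  · intro i _ j _ hij
    have h := Ideal.span_singleton_eq_span_singleton.1 hij
    rcases lt_trichotomy i j with hlt | rfl | hlt
    · exact (associated_pow_mul_pow_inj hqP hq hlt h).elim
    · rfl
    · exact (associated_pow_mul_pow_inj hqP hq hlt h.symm).elim

/-! ### The equation `c² + u² = N²` -/

/-- Both factors are powers of `p` whose exponents have even sum; distinct exponents would differ by
at least 2, giving a ratio of at least `p² ≥ 4 > 3`. -/
theorem eq_of_mul_eq_prime_pow_sq {p m A B : ℕ} (hp : p.Prime) (hAB : A * B = (p ^ m) ^ 2)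
    (h1 : A ≤ 3 * B) (h2 : B ≤ 3 * A) : A = B := by
  rw [← pow_mul] at hAB
  obtain ⟨i, -, rfl⟩ := (Nat.dvd_prime_pow hp).1 (Dvd.intro _ hAB)
  obtain ⟨j, -, rfl⟩ := (Nat.dvd_prime_pow hp).1 (Dvd.intro_left _ hAB)
  rw [← pow_add] at hAB
  have hij := Nat.pow_right_injective hp.two_le hAB
  have key : ∀ a b : ℕ, a + 2 ≤ b → ¬ p ^ b ≤ 3 * p ^ a := by
    intro a b hab h
    have h3 : p ^ (a + 2) ≤ p ^ b := Nat.pow_le_pow_right hp.pos hab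
    rw [pow_add] at h3
    have h4 : 0 < p ^ a := pow_pos hp.pos a
    nlinarith [hp.two_le, Nat.mul_le_mul hp.two_le hp.two_le]
  rcases lt_trichotomy i j with h | rfl | h
  · exact (key i j (by omega) h2).elim
  · rfl
  · exact (key j i (by omega) h1).elim

theorem eq_zero_of_sq_add_sq_eq_sq {p k u : ℕ} (hp : p.Prime) (hu : u = p ^ k ∨ u = 2 * p ^ k)
    {c N : ℤ} (hN : 0 < N) (hc : 2 * |c| ≤ N) (h : c ^ 2 + (u : ℤ) ^ 2 = N ^ 2) : c = 0 := by
  have hc1 := le_abs_self c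
  have hc2 := neg_abs_le c
  obtain ⟨A, hA⟩ := Int.eq_ofNat_of_zero_le (show 0 ≤ N + c by linarith)
  obtain ⟨B, hB⟩ := Int.eq_ofNat_of_zero_le (show 0 ≤ N - c by linarith)
  have hAB : A * B = u ^ 2 := by
    zify
    rw [← hA, ← hB]
    linear_combination -h
  have h1 : A ≤ 3 * B := by zify; linarith
  have h2 : B ≤ 3 * A := by zify; linarith
  suffices A = B by
    have : (A : ℤ) = B := by exact_mod_cast this
    linarith
  rcases hu with rfl | rfl
  · exact eq_of_mul_eq_prime_pow_sq hp hAB h1 h2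
  · rcases hp.eq_two_or_odd' with rfl | -
    -- For `p = 2`, `u` is itself a power of 2; for odd `p`, both factors are even and can be
    -- halved.
    · rw [← pow_succ'] at hAB
      exact eq_of_mul_eq_prime_pow_sq hp hAB h1 h2
    · have hev : Even A ↔ Even B := by
        have : Even ((A : ℤ) + B) := ⟨N, by linarith⟩
        have : Even (A + B) := by exact_mod_cast this
        simpa [parity_simps] using this
      have hA2 : Even A := by
        have : Even (A * B) := by rw [hAB, mul_pow]; exact ⟨2 * (p ^ k) ^ 2, by ring⟩
        rcases Nat.even_mul.1 this with h | h
        · exact h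
        · exact hev.2 h
      obtain ⟨a, rfl⟩ := hA2.two_dvd
      obtain ⟨b, rfl⟩ := (hev.1 hA2).two_dvd
      have : a = b := eq_of_mul_eq_prime_pow_sq (m := k) hp (by nlinarith) (by omega) (by omega)
      rw [this]

/-! ### Lattices in the plane from `ℤ[i]` -/

/-- The embedding of `ℤ[i]` in the Euclidean plane. -/
noncomputable def gaussianEmb : GaussianInt →ₗ[ℤ] EuclideanSpace ℝ (Fin 2) where
  toFun z := !₂[(z.re : ℝ), (z.im : ℝ)]
  map_add' z w := by ext i; fin_cases i <;> simp
  map_smul' n z := by ext i; fin_cases i <;> simp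

@[simp] theorem gaussianEmb_zero_apply (z : GaussianInt) : gaussianEmb z 0 = z.re := rfl

@[simp] theorem gaussianEmb_one_apply (z : GaussianInt) : gaussianEmb z 1 = z.im := rfl

theorem gaussianEmb_injective : Function.Injective gaussianEmb := by
  intro z w h
  have h0 := congrArg (fun v : EuclideanSpace ℝ (Fin 2) => v 0) h
  have h1 := congrArg (fun v : EuclideanSpace ℝ (Fin 2) => v 1) h
  ext
  · exact Int.cast_injective (α := ℝ) h0
  · exact Int.cast_injective (α := ℝ) h1

theorem norm_gaussianEmb (z : GaussianInt) : ‖gaussianEmb z‖ = √(z.norm : ℝ) := by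
  rw [EuclideanSpace.norm_eq, GaussianInt.norm_eq_sq_add_sq]
  simp

theorem norm_gaussianEmb_le_iff {z w : GaussianInt} :
    ‖gaussianEmb z‖ ≤ ‖gaussianEmb w‖ ↔ z.norm ≤ w.norm := by
  rw [norm_gaussianEmb, norm_gaussianEmb,
    Real.sqrt_le_sqrt_iff (by exact_mod_cast GaussianInt.norm_nonneg w)]
  exact_mod_cast Iff.rfl

theorem range_gaussianEmb : LinearMap.range gaussianEmb = integerLattice 2 := by
  apply le_antisymm
  · rintro _ ⟨z, rfl⟩
    have hz : gaussianEmb z = z.re • EuclideanSpace.basisFun (Fin 2) ℝ 0 +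
        z.im • EuclideanSpace.basisFun (Fin 2) ℝ 1 := by
      ext i; fin_cases i <;> simp
    rw [hz]
    exact add_mem (Submodule.smul_mem _ _ (Submodule.subset_span ⟨0, rfl⟩))
      (Submodule.smul_mem _ _ (Submodule.subset_span ⟨1, rfl⟩))
  · refine Submodule.span_le.2 ?_
    rintro _ ⟨j, rfl⟩
    fin_cases j
    · exact ⟨⟨1, 0⟩, by ext i; fin_cases i <;> simp⟩
    · exact ⟨⟨0, 1⟩, by ext i; fin_cases i <;> simp⟩

/-- The determinant of two Gaussian integers viewed as vectors. -/
def gaussianDet (a b : GaussianInt) : ℤ := a.re * b.im - a.im * b.re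

/-- Two Gaussian integers of nonzero determinant give a basis of the plane. -/
theorem exists_basis_of_gaussianDet_ne_zero {a b : GaussianInt} (h : gaussianDet a b ≠ 0) :
    ∃ B : Module.Basis (Fin 2) ℝ (EuclideanSpace ℝ (Fin 2)),
      (B : Fin 2 → EuclideanSpace ℝ (Fin 2)) = ![gaussianEmb a, gaussianEmb b] := by
  have hli : LinearIndependent ℝ ![gaussianEmb a, gaussianEmb b] := by
    rw [LinearIndependent.pair_iff]
    intro s t hst
    have h0 := congrArg (fun v : EuclideanSpace ℝ (Fin 2) => v 0) hst
    have h1 := congrArg (fun v : EuclideanSpace ℝ (Fin 2) => v 1) hst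
    simp [-GaussianInt.intCast_re, -GaussianInt.intCast_im] at h0 h1
    have hD : (a.re * b.im - a.im * b.re : ℝ) ≠ 0 := by exact_mod_cast h
    constructor
    · refine (mul_eq_zero.1 ?_).resolve_right hD
      linear_combination (b.im : ℝ) * h0 - b.re * h1
    · refine (mul_eq_zero.1 ?_).resolve_right hD
      linear_combination (a.re : ℝ) * h1 - a.im * h0
  exact ⟨basisOfLinearIndependentOfCardEqFinrank hli (by simp),
    coe_basisOfLinearIndependentOfCardEqFinrank hli (by simp)⟩

theorem span_gaussianEmb_pair {a b : GaussianInt} (h : gaussianDet a b ≠ 0) :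
    Submodule.span ℝ {gaussianEmb a, gaussianEmb b} = ⊤ := by
  obtain ⟨B, hB⟩ := exists_basis_of_gaussianDet_ne_zero h
  rw [← B.span_eq, hB]
  simp [Set.pair_comm]

theorem map_gaussianEmb_span_pair (a b : GaussianInt) :
    (Submodule.span ℤ {a, b}).map gaussianEmb =
      Submodule.span ℤ (Set.range ![gaussianEmb a, gaussianEmb b]) := by
  rw [Submodule.map_span, Set.image_pair]
  simp [Set.pair_comm]

theorem covolume_map_span_pair {a b : GaussianInt} (h : gaussianDet a b ≠ 0) :
    ZLattice.covolume ((Submodule.span ℤ {a, b}).map gaussianEmb) = |(gaussianDet a b : ℝ)| := by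
  obtain ⟨B, hB⟩ := exists_basis_of_gaussianDet_ne_zero h
  rw [map_gaussianEmb_span_pair, ← hB,
    ZLattice.covolume_eq_det_mul_measureReal _ _ (B.restrictScalars ℤ)
      (EuclideanSpace.basisFun (Fin 2) ℝ).toBasis,
    MeasureTheory.measureReal_congr (ZSpan.fundamentalDomain_ae_parallelepiped _ _)]
  have hvol : MeasureTheory.volume.real
      (parallelepiped (EuclideanSpace.basisFun (Fin 2) ℝ).toBasis) = 1 := by
    rw [MeasureTheory.measureReal_def, OrthonormalBasis.coe_toBasis,
      OrthonormalBasis.volume_parallelepiped]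
    simp
  rw [hvol, mul_one]
  congr 1
  rw [Module.Basis.det_apply, Matrix.det_fin_two]
  simp [Module.Basis.toMatrix_apply, hB, gaussianDet]
  ring

/-! ### Minimal vectors and reduction -/

theorem Int.exists_two_mul_abs_sub_le (s : ℤ) {D : ℤ} (hD : D ≠ 0) :
    ∃ m : ℤ, 2 * |s - m * D| ≤ |D| := by
  refine ⟨round ((s : ℚ) / D), ?_⟩
  have hDq : (D : ℚ) ≠ 0 := by exact_mod_cast hD
  have h := abs_sub_round ((s : ℚ) / D)
  have e : (s : ℚ) - round ((s : ℚ) / D) * D = ((s : ℚ) / D - round ((s : ℚ) / D)) * D := by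
    field_simp
  have : 2 * |(s : ℚ) - round ((s : ℚ) / D) * D| ≤ |(D : ℚ)| := by
    rw [e, abs_mul]
    nlinarith [abs_nonneg (D : ℚ)]
  exact_mod_cast this

/-- The real part of `star a * b`. -/
def gaussianDot (a b : GaussianInt) : ℤ := a.re * b.re + a.im * b.im

theorem gaussianDot_sq_add_gaussianDet_sq (a b : GaussianInt) :
    gaussianDot a b ^ 2 + gaussianDet a b ^ 2 = a.norm * b.norm := by
  simp only [GaussianInt.norm_eq_sq_add_sq, gaussianDot, gaussianDet]; ring

/-- `a` is a nonzero element of least norm in the subgroup `M` of `ℤ[i]`. -/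
def IsMinimalIn (M : Submodule ℤ GaussianInt) (a : GaussianInt) : Prop :=
  a ∈ M ∧ a ≠ 0 ∧ ∀ w ∈ M, w ≠ 0 → a.norm ≤ w.norm

theorem IsMinimalIn.norm_eq {M : Submodule ℤ GaussianInt} {a b : GaussianInt}
    (ha : IsMinimalIn M a) (hb : IsMinimalIn M b) : a.norm = b.norm :=
  le_antisymm (ha.2.2 b hb.1 hb.2.1) (hb.2.2 a ha.1 ha.2.1)

/-- Neither `a + b` nor `a - b` may be shorter than `a`. -/
theorem IsMinimalIn.two_mul_abs_gaussianDot_le {M : Submodule ℤ GaussianInt} {a b : GaussianInt}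
    (ha : IsMinimalIn M a) (hb : IsMinimalIn M b) (hD : gaussianDet a b ≠ 0) :
    2 * |gaussianDot a b| ≤ a.norm := by
  have hn := ha.norm_eq hb
  have h1 := ha.2.2 (a + b) (add_mem ha.1 hb.1) (fun h => hD (by
    rw [eq_neg_of_add_eq_zero_left h]; simp [gaussianDet]; ring))
  have h2 := ha.2.2 (a - b) (sub_mem ha.1 hb.1) (fun h => hD (by
    rw [sub_eq_zero.1 h]; simp [gaussianDet]; ring))
  rw [← abs_two, ← abs_mul, abs_le]
  simp only [GaussianInt.norm_eq_sq_add_sq, gaussianDot, Zsqrtd.re_add, Zsqrtd.im_add,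
    Zsqrtd.re_sub, Zsqrtd.im_sub] at *
  constructor <;> nlinarith

/-- Independent minimal vectors generate. -/
theorem IsMinimalIn.eq_span_pair {M : Submodule ℤ GaussianInt} {a b : GaussianInt}
    (ha : IsMinimalIn M a) (hb : IsMinimalIn M b) (hD : gaussianDet a b ≠ 0) :
    M = Submodule.span ℤ {a, b} := by
  have hc := ha.two_mul_abs_gaussianDot_le hb hD
  have hn := ha.norm_eq hb
  have hpos : 0 < a.norm := GaussianInt.norm_pos.2 ha.2.1
  refine le_antisymm (fun w hw => ?_) (Submodule.span_le.2 ?_)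
  swap
  · rintro x (rfl | rfl)
    exacts [ha.1, hb.1]
  -- By Cramer's rule the coordinates of `w` in the basis `a`, `b` are quotients of determinants;
  -- round each to a nearest integer.
  obtain ⟨m, hm⟩ := Int.exists_two_mul_abs_sub_le (gaussianDet w b) hD
  obtain ⟨n, hn'⟩ := Int.exists_two_mul_abs_sub_le (gaussianDet a w) hD
  set s := gaussianDet w b - m * gaussianDet a b with hs
  set t := gaussianDet a w - n * gaussianDet a b with ht
  set v := w - (m • a + n • b) with hv
  have hvM : v ∈ M :=
    sub_mem hw (add_mem (M.smul_mem m ha.1) (M.smul_mem n hb.1))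
  have hnorm : gaussianDet a b ^ 2 * v.norm =
      (s ^ 2 + t ^ 2) * a.norm + 2 * (s * t) * gaussianDot a b := by
    have h1 : gaussianDet a b * v.re = s * a.re + t * b.re := by
      simp [hv, hs, ht, gaussianDet]; ring
    have h2 : gaussianDet a b * v.im = s * a.im + t * b.im := by
      simp [hv, hs, ht, gaussianDet]; ring
    have h3 : (s ^ 2 + t ^ 2) * a.norm = s ^ 2 * a.norm + t ^ 2 * b.norm := by rw [← hn]; ring
    rw [h3]
    simp only [GaussianInt.norm_eq_sq_add_sq, gaussianDot]
    linear_combination (gaussianDet a b * v.re + (s * a.re + t * b.re)) * h1 +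
      (gaussianDet a b * v.im + (s * a.im + t * b.im)) * h2
  have hv0 : v = 0 := by
    by_contra hv0
    have hge := ha.2.2 v hvM hv0
    have hD2 : 0 < gaussianDet a b ^ 2 := by positivity
    have hs2 : 4 * s ^ 2 ≤ gaussianDet a b ^ 2 := by
      rw [← sq_abs s, ← sq_abs (gaussianDet a b)]
      nlinarith [abs_nonneg s]
    have ht2 : 4 * t ^ 2 ≤ gaussianDet a b ^ 2 := by
      rw [← sq_abs t, ← sq_abs (gaussianDet a b)]
      nlinarith [abs_nonneg t]
    have hst : 2 * |s * t| ≤ s ^ 2 + t ^ 2 := by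
      rw [abs_mul, ← sq_abs s, ← sq_abs t]
      nlinarith [sq_nonneg (|s| - |t|)]
    have hcross : 2 * (2 * (s * t) * gaussianDot a b) ≤ (s ^ 2 + t ^ 2) * a.norm := by
      calc 2 * (2 * (s * t) * gaussianDot a b)
          ≤ |2 * (2 * (s * t) * gaussianDot a b)| := le_abs_self _
        _ = (2 * |s * t|) * (2 * |gaussianDot a b|) := by
          simp only [abs_mul, abs_two]; ring
        _ ≤ (s ^ 2 + t ^ 2) * a.norm :=
          mul_le_mul hst hc (by positivity) (by positivity)
    -- With `D = gaussianDet a b`: `D² v.norm ≤ (3/2)(s² + t²) a.norm ≤ (3/4) D² a.norm`, against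
    -- minimality.
    nlinarith [mul_le_mul_of_nonneg_left hge hD2.le, mul_pos hD2 hpos,
      mul_le_mul_of_nonneg_right (add_le_add hs2 ht2) hpos.le]
  rw [sub_eq_zero.1 hv0, Submodule.mem_span_pair]
  exact ⟨m, n, rfl⟩

theorem gaussianEmb_mem_minimalVectors {M : Submodule ℤ GaussianInt} {a : GaussianInt} :
    gaussianEmb a ∈ minimalVectors (M.map gaussianEmb) ↔ IsMinimalIn M a := by
  constructor
  · rintro ⟨⟨a', ha', he⟩, ⟨y, -, hy0, hy⟩, hmin⟩
    obtain rfl := gaussianEmb_injective he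
    refine ⟨ha', ?_, fun w hw hw0 => ?_⟩
    · rintro rfl
      rw [map_zero, norm_zero] at hy
      exact hy0 (norm_eq_zero.1 hy.symm)
    · exact norm_gaussianEmb_le_iff.1 (hmin ⟨_, ⟨w, hw, rfl⟩,
        (map_ne_zero_iff _ gaussianEmb_injective).2 hw0, rfl⟩)
  · rintro ⟨haM, ha0, hmin⟩
    refine ⟨⟨a, haM, rfl⟩, ⟨_, ⟨a, haM, rfl⟩,
      (map_ne_zero_iff _ gaussianEmb_injective).2 ha0, rfl⟩, ?_⟩
    rintro _ ⟨_, ⟨w, hw, rfl⟩, hw0, rfl⟩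
    exact norm_gaussianEmb_le_iff.2
      (hmin w hw ((map_ne_zero_iff _ gaussianEmb_injective).1 hw0))

theorem exists_isMinimalIn_pair {M : Submodule ℤ GaussianInt}
    (h : IsWellRounded (M.map gaussianEmb)) :
    ∃ a b, IsMinimalIn M a ∧ IsMinimalIn M b ∧ gaussianDet a b ≠ 0 := by
  have hlift : ∀ x ∈ minimalVectors (M.map gaussianEmb), ∃ a, IsMinimalIn M a ∧
      gaussianEmb a = x := by
    intro x hx
    obtain ⟨a, -, rfl⟩ := hx.1
    exact ⟨a, gaussianEmb_mem_minimalVectors.1 hx, rfl⟩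
  have hne : (minimalVectors (M.map gaussianEmb)).Nonempty := by
    rw [Set.nonempty_iff_ne_empty]
    intro he
    rw [IsWellRounded, he, Submodule.span_empty] at h
    exact bot_ne_top h
  obtain ⟨x, hx⟩ := hne
  obtain ⟨a, ha, -⟩ := hlift x hx
  refine ⟨a, ?_⟩
  by_contra! hcon
  -- The functional `det(a, ·)` would kill every minimal vector, yet it takes the value `a.norm` at
  -- `i a`.
  let f : EuclideanSpace ℝ (Fin 2) →ₗ[ℝ] ℝ :=
    (a.re : ℝ) • (EuclideanSpace.proj 1).toLinearMap -
      (a.im : ℝ) • (EuclideanSpace.proj 0).toLinearMap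
  have hf : ∀ v, f v = a.re * v 1 - a.im * v 0 := fun v => rfl
  have hker : Submodule.span ℝ (minimalVectors (M.map gaussianEmb)) ≤ LinearMap.ker f := by
    refine Submodule.span_le.2 fun y hy => ?_
    obtain ⟨b, hb, rfl⟩ := hlift y hy
    have := hcon b ha hb
    rw [SetLike.mem_coe, LinearMap.mem_ker, hf]
    simp only [gaussianEmb_zero_apply, gaussianEmb_one_apply]
    exact_mod_cast this
  rw [h, top_le_iff] at hker
  have h0 : f (gaussianEmb ⟨-a.im, a.re⟩) = 0 := by
    rw [← LinearMap.mem_ker, hker]; trivial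
  rw [hf] at h0
  simp only [gaussianEmb_zero_apply, gaussianEmb_one_apply] at h0
  have h1 : a.norm = 0 := by
    rw [GaussianInt.norm_eq_sq_add_sq]
    have : a.re * a.re - a.im * -a.im = 0 := by exact_mod_cast h0
    linarith
  exact ha.2.1 (GaussianInt.norm_eq_zero.1 h1)

theorem isMinimalIn_span_singleton {a b : GaussianInt} (ha : a ≠ 0) (hb : b ∈ Ideal.span {a})
    (hn : b.norm = a.norm) :
    IsMinimalIn ((Ideal.span {a}).restrictScalars ℤ) b := by
  refine ⟨hb, ?_, ?_⟩
  · rintro rfl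
    rw [Zsqrtd.norm_zero] at hn
    exact ha (GaussianInt.norm_eq_zero.1 hn.symm)
  · intro w hw hw0
    obtain ⟨z, rfl⟩ := Ideal.mem_span_singleton.1 hw
    have hz := GaussianInt.norm_pos.2 (right_ne_zero_of_mul hw0)
    rw [Zsqrtd.norm_mul, hn]
    nlinarith [GaussianInt.norm_pos.2 ha]

/-! ### Well-rounded lattices as ideals -/

/-- An ideal of `ℤ[i]`, as a lattice in the plane. -/
noncomputable def idealLattice (I : Ideal GaussianInt) :
    Submodule ℤ (EuclideanSpace ℝ (Fin 2)) :=
  (I.restrictScalars ℤ).map gaussianEmb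

theorem idealLattice_injective : Function.Injective idealLattice := fun _ _ h =>
  Submodule.restrictScalars_injective ℤ _ _
    (Submodule.map_injective_of_injective gaussianEmb_injective h)

theorem idealLattice_mem_WR {a : GaussianInt} (ha : a ≠ 0) :
    idealLattice (Ideal.span {a}) ∈ WR (integerLattice 2) ∧
      ZLattice.covolume (idealLattice (Ideal.span {a})) = (a.norm : ℝ) := by
  have hn : (⟨-a.im, a.re⟩ : GaussianInt).norm = a.norm := by
    simp only [GaussianInt.norm_eq_sq_add_sq]; ring
  have hD : gaussianDet a ⟨-a.im, a.re⟩ = a.norm := by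
    simp only [GaussianInt.norm_eq_sq_add_sq, gaussianDet]; ring
  have hpos := GaussianInt.norm_pos.2 ha
  have hD0 : gaussianDet a ⟨-a.im, a.re⟩ ≠ 0 := hD ▸ hpos.ne'
  have h1 := isMinimalIn_span_singleton ha (Ideal.mem_span_singleton_self a) rfl
  have h2 := isMinimalIn_span_singleton (b := ⟨-a.im, a.re⟩) ha
    (Ideal.mem_span_singleton.2 ⟨⟨0, 1⟩, by ext <;> simp⟩) hn
  have hwr : IsWellRounded (idealLattice (Ideal.span {a})) := by
    rw [IsWellRounded, eq_top_iff, ← span_gaussianEmb_pair hD0]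
    refine Submodule.span_mono ?_
    rintro _ (rfl | rfl)
    exacts [gaussianEmb_mem_minimalVectors.2 h1, gaussianEmb_mem_minimalVectors.2 h2]
  refine ⟨⟨?_, ?_, hwr⟩, ?_⟩
  · rw [← range_gaussianEmb]
    exact LinearMap.map_le_range
  · rw [eq_top_iff, ← hwr]
    exact Submodule.span_mono fun x hx => hx.1
  · rw [idealLattice, h1.eq_span_pair h2 hD0, covolume_map_span_pair hD0, hD, abs_of_nonneg]
    exact_mod_cast hpos.le

theorem numWR_eq_encard_idealsOfNorm {p k u : ℕ} (hp : p.Prime)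
    (hu : u = p ^ k ∨ u = 2 * p ^ k) : numWR u = (idealsOfNorm u).encard := by
  have hu0 : 0 < u := by
    have := pow_pos hp.pos k
    rcases hu with rfl | rfl <;> positivity
  rw [numWR, ← idealLattice_injective.encard_image]
  congr 1
  ext L
  constructor
  · rintro ⟨⟨hL, -, hwr⟩, hcov⟩
    obtain ⟨M, rfl⟩ : ∃ M : Submodule ℤ GaussianInt, M.map gaussianEmb = L :=
      ⟨L.comap gaussianEmb, Submodule.map_comap_eq_of_le (range_gaussianEmb ▸ hL)⟩
    obtain ⟨a, b, ha, hb, hD⟩ := exists_isMinimalIn_pair hwr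
    have hM := ha.eq_span_pair hb hD
    have hc := ha.two_mul_abs_gaussianDot_le hb hD
    have hn := ha.norm_eq hb
    have hpos := GaussianInt.norm_pos.2 ha.2.1
    rw [hM, covolume_map_span_pair hD] at hcov
    have hDu : |gaussianDet a b| = u := by exact_mod_cast hcov
    have hsq := gaussianDot_sq_add_gaussianDet_sq a b
    rw [← sq_abs (gaussianDet a b), hDu, ← hn, ← pow_two] at hsq
    have hc0 := eq_zero_of_sq_add_sq_eq_sq hp hu hpos hc hsq
    have hNu : a.norm = u := by
      rw [hc0] at hsq
      nlinarith
    -- `star a * b = c + i D` with `c = 0`; multiply by `a`.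
    have hprod : b * (a.norm : GaussianInt) = a * ⟨0, gaussianDet a b⟩ := by
      rw [GaussianInt.norm_eq_sq_add_sq]
      rw [gaussianDot] at hc0
      ext
      · simp [gaussianDet, pow_two]
        linear_combination a.re * hc0
      · simp [gaussianDet, pow_two]
        linear_combination a.im * hc0
    have hab : b ∈ Ideal.span {a} := by
      rw [Ideal.mem_span_singleton]
      rcases abs_eq_abs.1 (hDu.trans (by rw [← hNu, abs_of_pos hpos]) : |gaussianDet a b| = |a.norm|)
        with h | h
      · refine ⟨⟨0, 1⟩, ?_⟩
        have h0 : (a.norm : GaussianInt) ≠ 0 := by exact_mod_cast hpos.ne'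
        apply mul_right_cancel₀ h0
        rw [hprod, h, mul_assoc]
        congr 1
        ext <;> simp
      · refine ⟨⟨0, -1⟩, ?_⟩
        have h0 : (a.norm : GaussianInt) ≠ 0 := by exact_mod_cast hpos.ne'
        apply mul_right_cancel₀ h0
        rw [hprod, h, mul_assoc]
        congr 1
        ext <;> simp
    refine ⟨Ideal.span {a}, ⟨a, hNu, rfl⟩, ?_⟩
    have h1 := isMinimalIn_span_singleton ha.2.1 (Ideal.mem_span_singleton_self a) rfl
    have h2 := isMinimalIn_span_singleton ha.2.1 hab hn.symm
    rw [idealLattice, h1.eq_span_pair h2 hD, hM]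
  · rintro ⟨_, ⟨a, ha, rfl⟩, rfl⟩
    have ha0 : a ≠ 0 := by
      rintro rfl
      rw [Zsqrtd.norm_zero] at ha
      omega
    obtain ⟨h1, h2⟩ := idealLattice_mem_WR ha0
    exact ⟨h1, by rw [h2, ha]; simp⟩

theorem mainTheorem7 (p k u : ℕ) (hp : p.Prime) (hk : 0 < k) (hu : u = p ^ k ∨ u = 2 * p ^ k) :
    (p % 4 = 3 → Odd k → numWR u = 0) ∧
    (p % 4 = 3 → Even k → numWR u = 1) ∧
    (p = 2 → numWR u = 1) ∧
    (p % 4 = 1 → numWR u = (k : ℕ∞) + 1) := by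
  have h : numWR u = (idealsOfNorm ((p : ℤ) ^ k)).encard := by
    rw [numWR_eq_encard_idealsOfNorm hp hu]
    rcases hu with rfl | rfl
    · push_cast; rfl
    · push_cast; exact encard_idealsOfNorm_two_mul _
  rw [h]
  refine ⟨fun h3 ho => ?_, fun h3 he => encard_idealsOfNorm_even_pow hp h3 he, ?_,
    fun h1 => encard_idealsOfNorm_split_pow k hp h1⟩
  · rw [idealsOfNorm_odd_pow hp h3 ho, Set.encard_empty]
  · rintro rfl
    exact encard_idealsOfNorm_two_pow k
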